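/- Let $\mathcal Z\subset\mathbb R^d$ be open and bounded, let $\|\cdot\|$ be a norm on $\mathbb R^d$ with dual norm $\|\cdot\|_*$, let $\mathbb P_{\mathrm{data}}$ be a Borel probability measure on $\mathcal Z$, and let $z_1,z_2,\dots$ be i.i.d. with law $\mathbb P_{\mathrm{data}}$. Let $(\alpha_n)_{n\ge1}$ and $(\beta_n)_{n\ge1}$ be sequences of positive numbers converging to zero. Let $C_{\mathrm H},C_\nabla,L>0$, $k\in(0,1]$, $M\ge\sup_n\beta_n$ and $p\in(1+k,\infty)$ be constants, let $p^*=(1-1/p)^{-1}$, let $\mathcal B(M)=\{r\in\mathbb R^d:\|r\|\le M\}$, and let $D=\mathrm{Conv}(\mathcal Z)+\mathcal B(M)$. Let $\mathcal H$ be a uniformly bounded set of differentiable functions $h:D\to\mathbb R$ such that, for every $h\in\mathcal H$: - $\|\nabla h(z)-\nabla h(\tilde z)\|_*\le C_{\mathrm H}\|z-\tilde z\|^k$ for all $z,\tilde z\in D$; - $\int\|\nabla h\|_*\,d\mathbb P_{\mathrm{data}}\ge C_\nabla$; - $h$ is $L$-Lipschitz on $D$. For each $n\ge1$ let $\mathbb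 P_n'=\frac1n\sum_{i=1}^n\delta_{z_i'}$, where the points $z_1',\dots,z_n'$ (which may be random) satisfy $\|z_i'-z_i\|\le\beta_n$ for all $i$, and let $\hat h_n\in\mathcal H$ be a minimizer over $h\in\mathcal H$ of $$\int h\,d\mathbb P_n'+\alpha_n\Big(\int\|\nabla h\|_*^{p^*}\,d\mathbb P_n'\Big)^{1/p^*}.$$ Then $$\int\hat h_n\,d\mathbb P_{\mathrm{data}}-\inf_{h\in\mathcal H}\int h\,d\mathbb P_{\mathrm{data}}=O_p\Big(\mathfrak R_n(\mathcal H)\vee n^{-1/2}\vee\alpha_n\vee\log(n)\,(\alpha_n^{1+k}\vee\beta_n)\Big).$$ Here $\mathfrak R_n(\mathcal H)=\mathbb E\big[\frac1n\sup_{h\in\mathcal H}\big|\sum_{i=1}^n\sigma_i h(z_i)\big|\big]$ with $\sigma_1,\dots,\sigma_n$ independent uniform signs in $\{1,-1\}$, independent of the sample, and $B_n=O_p(a_n)$ means that for every $\varepsilon>0$ there are constants $C$ and $n_0$ with $P(|B_n|>C a_n)<\varepsilon$ for all $n\ge n_0$. -/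

import Mathlib

open MeasureTheory ProbabilityTheory Filter Topology
open scoped NNReal ENNReal Pointwise

noncomputable section

namespace PerturbedWDRO

/-- `B n = O_p(a n)` under the probability measure `μ`: for every `ε > 0` there are a constant `C`
and an index `n₀` with `μ(|B n| > C * a n) < ε` for all `n ≥ n₀`.
(For events that are not measurable, `μ` is the outer measure.) -/
def IsBigOInProb {Ω : Type*} [MeasurableSpace Ω] (μ : Measure Ω) (B : ℕ → Ω → ℝ)
    (a : ℕ → ℝ) : Prop :=
  ∀ ε : ℝ, 0 < ε → ∃ (C : ℝ) (n₀ : ℕ), ∀ n : ℕ, n₀ ≤ n →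
    μ {ω | C * a n < |B n ω|} < ENNReal.ofReal ε

section

variable {E : Type*} [NormedAddCommGroup E] [NormedSpace ℝ E] [MeasurableSpace E]

/-- The uniform distribution `(1/n) ∑ δ_{z i}` on the points `z 0, …, z (n - 1)`. -/
def empirical {n : ℕ} (z : Fin n → E) : Measure E :=
  (n : ℝ≥0∞)⁻¹ • ∑ i, Measure.dirac (z i)

/-- `Q` is a `β`-locally perturbed data distribution of the dataset `z`: it is the uniform
distribution on points `z' i` that lie within `β` of the `z i`. -/
def IsLocallyPerturbed {n : ℕ} (β : ℝ) (z : Fin n → E) (Q : Measure E) : Prop :=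
  ∃ z' : Fin n → E, Q = empirical z' ∧ ∀ i, ‖z' i - z i‖ ≤ β

/-- The risk `R(Q, h) = ∫ h dQ`. -/
def risk (Q : Measure E) (h : E → ℝ) : ℝ := ∫ z, h z ∂Q

/-- `‖∇h‖_{Q, r} = (∫ ‖∇h(z)‖_* ^ r dQ(z))^{1/r}`. The derivative is a continuous linear
functional, and its operator norm is the dual norm of the gradient. -/
def gradNorm (Q : Measure E) (r : ℝ) (h : E → ℝ) : ℝ :=
  (∫ z, ‖fderiv ℝ h z‖ ^ r ∂Q) ^ (1 / r)

/-- The penalized objective `R(Q, h) + a ‖∇h‖_{Q, p*}`, with `p*` the Hölder conjugate of `p`. -/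
def penalizedRisk (a p : ℝ) (Q : Measure E) (h : E → ℝ) : ℝ :=
  risk Q h + a * gradNorm Q (Real.conjExponent p) h

/-- The excess risk `R(P, g) - inf_{h ∈ H} R(P, h)`. -/
def excessRisk (P : Measure E) (H : Set (E → ℝ)) (g : E → ℝ) : ℝ :=
  risk P g - ⨅ h : H, risk P (h : E → ℝ)

/-- The Rademacher complexity
`E_{Z_1, …, Z_n ~ P} E_σ [(1/n) sup_{s ∈ S} |∑ σ_i s(Z_i)|]`, where `σ` is uniform on
`{1, -1}^n`. -/
def rademacherComplexity (P : Measure E) (n : ℕ) (S : Set (E → ℝ)) : ℝ :=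
  ∫ z : Fin n → E,
    ((2 : ℝ) ^ n)⁻¹ * ∑ σ : Fin n → ℤˣ,
      (n : ℝ)⁻¹ * ⨆ s : S, |∑ i, (((σ i : ℤˣ) : ℤ) : ℝ) * (s : E → ℝ) (z i)|
    ∂(Measure.pi fun _ => P)

end

section

variable {E : Type*} [NormedAddCommGroup E] [NormedSpace ℝ E]

/-- The set `Conv(Z) + B(M)`, with `B(M)` the closed ball of radius `M` about the origin, on
which losses are defined. It is open when `Z` is. -/
def lossDomain (Z : Set E) (M : ℝ) : Set E := convexHull ℝ Z + Metric.closedBall 0 M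

end

end PerturbedWDRO

end

/-!
The penalty plays no role beyond its size: every loss has gradient norm at most `L` on the open
domain, so the penalty of the minimizer and of any competitor lies in `[0, α n * L]`, and the
perturbation of the sample changes each empirical risk by at most `L * β n`. Comparing the
minimizer with an arbitrary competitor (`abs_excessRisk_le`) therefore bounds the excess risk by
twice the uniform deviation `sup_h |∫ h dPₙ - ∫ h dP|`, plus `2 * L * β n + α n * L`. The last two
terms are at most `3 * L` times the rate as soon as `log n ≥ 1`.

The expected uniform deviation is at most twice the Rademacher complexity, by symmetrization with
an independent copy of the sample (`integral_centredSup_le`). As the rate dominates the Rademacher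
complexity, Markov's inequality gives boundedness in probability; no concentration inequality is
needed.

Suprema over the possibly uncountable class have to be measurable, since otherwise the integral
defining the Rademacher complexity would be a junk value. The losses are controlled only on
`lossDomain Z M`, where they are Lipschitz and uniformly bounded. They are replaced by continuous
extensions to the whole space with the same bound, which changes nothing almost surely; a supremum
of a bounded family of continuous functions is lower semicontinuous, hence measurable.
-/

/-! ### Suprema of bounded families of continuous functions -/

section Suprema

variable {ι W : Type*}

theorem bddAbove_range_abs {g : ι → W → ℝ} {C : ℝ} (hC : ∀ i w, |g i w| ≤ C) (w : W) :
    BddAbove (Set.range fun i => |g i w|) :=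
  ⟨C, by rintro _ ⟨i, rfl⟩; exact hC i w⟩

theorem abs_le_iSup_abs {g : ι → W → ℝ} {C : ℝ} (hC : ∀ i w, |g i w| ≤ C) (w : W) (i : ι) :
    |g i w| ≤ ⨆ i, |g i w| :=
  le_ciSup (bddAbove_range_abs hC w) i

/-- The supremum of an arbitrary, possibly uncountable, family is measurable here because it is
lower semicontinuous. -/
theorem measurable_iSup_abs [TopologicalSpace W] [MeasurableSpace W] [OpensMeasurableSpace W]
    {g : ι → W → ℝ} {C : ℝ} (hg : ∀ i, Continuous (g i)) (hC : ∀ i w, |g i w| ≤ C) :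
    Measurable fun w => ⨆ i, |g i w| :=
  (lowerSemicontinuous_ciSup (bddAbove_range_abs hC)
    fun i => (hg i).abs.lowerSemicontinuous).measurable

theorem integrable_iSup_abs [Nonempty ι] [TopologicalSpace W] [MeasurableSpace W]
    [OpensMeasurableSpace W] (ν : Measure W) [IsFiniteMeasure ν] {g : ι → W → ℝ} {C : ℝ}
    (hg : ∀ i, Continuous (g i)) (hC : ∀ i w, |g i w| ≤ C) :
    Integrable (fun w => ⨆ i, |g i w|) ν := by
  refine Integrable.of_bound (measurable_iSup_abs hg hC).aestronglyMeasurable C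
    (Eventually.of_forall fun w => ?_)
  rw [Real.norm_of_nonneg (Real.iSup_nonneg fun i => abs_nonneg _)]
  exact ciSup_le fun i => hC i w

end Suprema

/-! ### Symmetrization -/

section Symmetrization

variable {ι V : Type*} {n : ℕ}

/-- The supremum over the family `f` of the Rademacher sums `|∑ⱼ σⱼ f i (z j)|`. -/
noncomputable def signedSup (f : ι → V → ℝ) (σ : Fin n → ℤˣ) (z : Fin n → V) : ℝ :=
  ⨆ i, |∑ j, (((σ j : ℤˣ) : ℤ) : ℝ) * f i (z j)|

/-- The supremum over the family `f` of the signed sums of differences between the first and the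
second coordinates of the pairs `w j`. -/
noncomputable def signedDiffSup (f : ι → V → ℝ) (σ : Fin n → ℤˣ) (w : Fin n → V × V) : ℝ :=
  ⨆ i, |∑ j, (((σ j : ℤˣ) : ℤ) : ℝ) * (f i (w j).1 - f i (w j).2)|

/-- The supremum over the family `f` of the centred sums `|∑ⱼ (f i (z j) - ∫ f i dP)|`. -/
noncomputable def centredSup [MeasurableSpace V] (P : Measure V) (f : ι → V → ℝ)
    (z : Fin n → V) : ℝ :=
  ⨆ i, |∑ j, (f i (z j) - ∫ x, f i x ∂P)|

theorem abs_sum_fin_le {a : Fin n → ℝ} {C : ℝ} (h : ∀ j, |a j| ≤ C) : |∑ j, a j| ≤ n * C :=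
  (Finset.abs_sum_le_sum_abs _ _).trans <|
    (Finset.sum_le_card_nsmul _ _ C fun j _ => h j).trans (by simp)

theorem abs_sign (u : ℤˣ) : |((u : ℤ) : ℝ)| = 1 := by
  rcases Int.units_eq_one_or u with rfl | rfl <;> simp

theorem abs_sum_sign_mul_le {σ : Fin n → ℤˣ} {a : Fin n → ℝ} {C : ℝ} (h : ∀ j, |a j| ≤ C) :
    |∑ j, (((σ j : ℤˣ) : ℤ) : ℝ) * a j| ≤ n * C :=
  abs_sum_fin_le fun j => by rw [abs_mul, abs_sign, one_mul]; exact h j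

variable {f : ι → V → ℝ} {B : ℝ}

theorem abs_sub_le_add_self {a b : ℝ} (ha : |a| ≤ B) (hb : |b| ≤ B) : |a - b| ≤ B + B :=
  (abs_sub _ _).trans (add_le_add ha hb)

/-- Exchanging the two entries of the `j`-th pair flips the sign of the `j`-th difference. -/
theorem signedDiffSup_swap (σ : Fin n → ℤˣ) (w : Fin n → V × V) :
    signedDiffSup f 1 (fun j => if σ j = 1 then w j else (w j).swap) = signedDiffSup f σ w := by
  unfold signedDiffSup
  congr! 4 with i j
  rcases Int.units_eq_one_or (σ j) with h | h
  · simp [h]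
  · simp [h, show (-1 : ℤˣ) ≠ 1 by decide]

theorem signedDiffSup_le_add [Nonempty ι] (hB : ∀ i x, |f i x| ≤ B) (σ : Fin n → ℤˣ)
    (w : Fin n → V × V) :
    signedDiffSup f σ w ≤
      signedSup f σ (fun j => (w j).1) + signedSup f σ (fun j => (w j).2) := by
  have hb : ∀ i (z : Fin n → V), |∑ j, (((σ j : ℤˣ) : ℤ) : ℝ) * f i (z j)| ≤ n * B :=
    fun i z => abs_sum_sign_mul_le fun j => hB i (z j)
  refine ciSup_le fun i => ?_
  simp only [mul_sub, Finset.sum_sub_distrib]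
  exact (abs_sub _ _).trans (add_le_add (abs_le_iSup_abs hb _ i) (abs_le_iSup_abs hb _ i))

theorem abs_integral_le_of_abs_le [MeasurableSpace V] (P : Measure V)
    [IsProbabilityMeasure P] {g : V → ℝ} (hg : ∀ x, |g x| ≤ B) :
    |∫ x, g x ∂P| ≤ B := by
  have h := norm_integral_le_of_norm_le_const (μ := P) (f := g) (C := B) (Eventually.of_forall hg)
  simpa using h

/-- The pairs `(Zⱼ, Z'ⱼ)` are exchangeable within themselves, so signs do not change the law of
the supremum. -/
theorem integral_signedDiffSup [MeasurableSpace V] (P : Measure V) [IsProbabilityMeasure P]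
    (σ : Fin n → ℤˣ) :
    ∫ w, signedDiffSup f 1 w ∂(Measure.pi fun _ : Fin n => P.prod P) =
      ∫ w, signedDiffSup f σ w ∂(Measure.pi fun _ : Fin n => P.prod P) := by
  let e : ∀ _ : Fin n, V × V ≃ᵐ V × V := fun j =>
    if σ j = 1 then MeasurableEquiv.refl _ else MeasurableEquiv.prodComm
  have he : MeasurePreserving (MeasurableEquiv.piCongrRight e)
      (Measure.pi fun _ : Fin n => P.prod P) (Measure.pi fun _ : Fin n => P.prod P) := by
    refine measurePreserving_pi _ _ fun j => ?_
    by_cases h : σ j = 1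
    · simpa [e, h] using MeasurePreserving.id (P.prod P)
    · simp only [e, h, if_false]
      exact Measure.measurePreserving_swap
  rw [← he.integral_comp']
  congr 1
  funext w
  rw [← signedDiffSup_swap σ w]
  congr 1
  funext j
  by_cases h : σ j = 1 <;> simp [e, h, MeasurableEquiv.piCongrRight, MeasurableEquiv.prodComm]

variable [TopologicalSpace V] [SecondCountableTopology V] [MeasurableSpace V]
  [OpensMeasurableSpace V]

theorem integrable_signedSup [Nonempty ι] (hf : ∀ i, Continuous (f i))
    (hB : ∀ i x, |f i x| ≤ B) (ν : Measure (Fin n → V)) [IsFiniteMeasure ν]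
    (σ : Fin n → ℤˣ) : Integrable (signedSup f σ) ν :=
  integrable_iSup_abs (C := n * B) ν (fun i => by have := hf i; fun_prop)
    fun i z => abs_sum_sign_mul_le fun j => hB i (z j)

theorem integrable_signedDiffSup [Nonempty ι] (hf : ∀ i, Continuous (f i))
    (hB : ∀ i x, |f i x| ≤ B) (ν : Measure (Fin n → V × V)) [IsFiniteMeasure ν]
    (σ : Fin n → ℤˣ) : Integrable (signedDiffSup f σ) ν :=
  integrable_iSup_abs (C := n * (B + B)) ν (fun i => by have := hf i; fun_prop)
    fun i w => abs_sum_sign_mul_le fun j => abs_sub_le_add_self (hB i _) (hB i _)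

variable (P : Measure V) [IsProbabilityMeasure P]

theorem integrable_centredSup [Nonempty ι] (hf : ∀ i, Continuous (f i))
    (hB : ∀ i x, |f i x| ≤ B) (ν : Measure (Fin n → V)) [IsFiniteMeasure ν] :
    Integrable (centredSup P f) ν :=
  integrable_iSup_abs (C := n * (B + B)) ν (fun i => by have := hf i; fun_prop)
    fun i z => abs_sum_fin_le fun j =>
      abs_sub_le_add_self (hB i _) (abs_integral_le_of_abs_le P (hB i))

/-- An independent copy of the sample replaces the means: this is Jensen's inequality, in the form
that a supremum of integrals is at most the integral of the supremum. -/
theorem centredSup_le_integral [Nonempty ι] (hf : ∀ i, Continuous (f i))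
    (hB : ∀ i x, |f i x| ≤ B) (z : Fin n → V) :
    centredSup P f z ≤
      ∫ z' : Fin n → V, signedDiffSup f 1 (fun j => (z j, z' j)) ∂(Measure.pi fun _ => P) := by
  have hb : ∀ i (z' : Fin n → V), |∑ j, (f i (z j) - f i (z' j))| ≤ n * (B + B) :=
    fun i z' => abs_sum_fin_le fun j => abs_sub_le_add_self (hB i _) (hB i _)
  have hc : ∀ i, Continuous fun z' : Fin n → V => ∑ j, (f i (z j) - f i (z' j)) :=
    fun i => by have := hf i; fun_prop
  have hint : ∀ i j, Integrable (fun z' : Fin n → V => f i (z' j)) (Measure.pi fun _ => P) :=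
    fun i j => Integrable.of_bound
      (((hf i).comp (continuous_apply j)).measurable.aestronglyMeasurable) B
      (Eventually.of_forall fun z' => hB i _)
  refine ciSup_le fun i => ?_
  have key : ∑ j, (f i (z j) - ∫ x, f i x ∂P) =
      ∫ z' : Fin n → V, ∑ j, (f i (z j) - f i (z' j)) ∂(Measure.pi fun _ => P) := by
    have hsub : ∀ j ∈ Finset.univ, Integrable (fun z' : Fin n → V => f i (z j) - f i (z' j))
        (Measure.pi fun _ => P) := fun j _ => (integrable_const _).sub (hint i j)
    rw [integral_finsetSum _ hsub]
    refine Finset.sum_congr rfl fun j _ => ?_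
    rw [integral_sub (integrable_const _) (hint i j),
      integral_comp_eval (μ := fun _ : Fin n => P) (hf i).measurable.aestronglyMeasurable]
    simp
  rw [key]
  refine abs_integral_le_integral_abs.trans (integral_mono ?_ ?_ fun z' => ?_)
  · exact (Integrable.of_bound (hc i).measurable.aestronglyMeasurable (n * (B + B))
      (Eventually.of_forall (hb i))).abs
  · simpa [signedDiffSup] using integrable_iSup_abs (Measure.pi fun _ : Fin n => P) hc hb
  · simpa [signedDiffSup] using abs_le_iSup_abs hb z' i

/-- **Symmetrization**, for unnormalized sums. -/
theorem integral_centredSup_le [Nonempty ι] (hf : ∀ i, Continuous (f i))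
    (hB : ∀ i x, |f i x| ≤ B) :
    ∫ z : Fin n → V, centredSup P f z ∂(Measure.pi fun _ => P) ≤
      2 * (((2 : ℝ) ^ n)⁻¹ *
        ∑ σ : Fin n → ℤˣ, ∫ z, signedSup f σ z ∂(Measure.pi fun _ => P)) := by
  set Pn : Measure (Fin n → V) := Measure.pi fun _ => P
  set PPn : Measure (Fin n → V × V) := Measure.pi fun _ => P.prod P
  have mp : MeasurePreserving (MeasurableEquiv.arrowProdEquivProdArrow V V (Fin n)) PPn
      (Pn.prod Pn) :=
    measurePreserving_arrowProdEquivProdArrow V V (Fin n) (fun _ => P) (fun _ => P)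
  have hfst : MeasurePreserving (fun (w : Fin n → V × V) j => (w j).1) PPn Pn :=
    measurePreserving_pi _ _ fun _ => measurePreserving_fst
  have hsnd : MeasurePreserving (fun (w : Fin n → V × V) j => (w j).2) PPn Pn :=
    measurePreserving_pi _ _ fun _ => measurePreserving_snd
  have hS := integrable_signedSup hf hB Pn
  have hD := integrable_signedDiffSup hf hB PPn
  have hDprod : Integrable (fun q : (Fin n → V) × (Fin n → V) =>
      signedDiffSup f 1 fun j => (q.1 j, q.2 j)) (Pn.prod Pn) :=
    (mp.integrable_comp_emb (MeasurableEquiv.measurableEmbedding _)).1 (hD 1)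
  have h1 : ∫ z, centredSup P f z ∂Pn ≤ ∫ w, signedDiffSup f 1 w ∂PPn := by
    calc ∫ z, centredSup P f z ∂Pn
        ≤ ∫ z, ∫ z', signedDiffSup f 1 (fun j => (z j, z' j)) ∂Pn ∂Pn :=
          integral_mono (integrable_centredSup P hf hB Pn) hDprod.integral_prod_left
            fun z => centredSup_le_integral P hf hB z
      _ = ∫ q, signedDiffSup f 1 (fun j => (q.1 j, q.2 j)) ∂(Pn.prod Pn) :=
          (integral_prod _ hDprod).symm
      _ = ∫ w, signedDiffSup f 1 w ∂PPn := (mp.integral_comp' _).symm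
  have h2 : ∀ σ : Fin n → ℤˣ,
      ∫ w, signedDiffSup f 1 w ∂PPn ≤ 2 * ∫ z, signedSup f σ z ∂Pn := by
    intro σ
    have i1 : Integrable (fun w : Fin n → V × V => signedSup f σ fun j => (w j).1) PPn :=
      hfst.integrable_comp_of_integrable (hS σ)
    have i2 : Integrable (fun w : Fin n → V × V => signedSup f σ fun j => (w j).2) PPn :=
      hsnd.integrable_comp_of_integrable (hS σ)
    have e1 : ∫ w : Fin n → V × V, signedSup f σ (fun j => (w j).1) ∂PPn =
        ∫ z, signedSup f σ z ∂Pn := by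
      rw [← hfst.map_eq, integral_map hfst.measurable.aemeasurable]
      rw [hfst.map_eq]; exact (hS σ).aestronglyMeasurable
    have e2 : ∫ w : Fin n → V × V, signedSup f σ (fun j => (w j).2) ∂PPn =
        ∫ z, signedSup f σ z ∂Pn := by
      rw [← hsnd.map_eq, integral_map hsnd.measurable.aemeasurable]
      rw [hsnd.map_eq]; exact (hS σ).aestronglyMeasurable
    rw [integral_signedDiffSup P σ]
    refine (integral_mono (hD σ) (i1.add i2) (signedDiffSup_le_add hB σ)).trans_eq ?_
    rw [integral_add' i1 i2, e1, e2, two_mul]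
  have hcard : (Fintype.card (Fin n → ℤˣ) : ℝ) = 2 ^ n := by simp
  have h3 : (2 : ℝ) ^ n * ∫ z, centredSup P f z ∂Pn ≤
      2 * ∑ σ : Fin n → ℤˣ, ∫ z, signedSup f σ z ∂Pn := by
    rw [Finset.mul_sum, ← hcard, ← nsmul_eq_mul]
    exact Finset.card_nsmul_le_sum _ _ _ fun σ _ => h1.trans (h2 σ)
  rw [mul_left_comm, ← div_eq_inv_mul, le_div_iff₀ (by positivity), mul_comm]
  exact h3

end Symmetrization

namespace PerturbedWDRO

/-! ### Risks and gradient norms of empirical measures -/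

section Empirical

variable {E : Type*} [MeasurableSpace E] {n : ℕ}

theorem integral_empirical [MeasurableSingletonClass E] (z : Fin n → E) (g : E → ℝ) :
    ∫ x, g x ∂(empirical z) = (n : ℝ)⁻¹ * ∑ i, g (z i) := by
  rw [empirical, integral_smul_measure,
    integral_finsetSum_measure fun i _ => integrable_dirac (by simp)]
  simp [integral_dirac]

theorem inv_mul_abs_sum_le (hn : n ≠ 0) {a : Fin n → ℝ} {C : ℝ} (h : ∀ i, |a i| ≤ C) :
    (n : ℝ)⁻¹ * |∑ i, a i| ≤ C := by
  rw [inv_mul_le_iff₀ (by positivity)]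
  exact abs_sum_fin_le h

theorem gradNorm_nonneg [NormedAddCommGroup E] [NormedSpace ℝ E] (Q : Measure E) (r : ℝ)
    (h : E → ℝ) : 0 ≤ gradNorm Q r h :=
  Real.rpow_nonneg (integral_nonneg fun _ => Real.rpow_nonneg (norm_nonneg _) _) _

theorem gradNorm_empirical_le [NormedAddCommGroup E] [NormedSpace ℝ E]
    [MeasurableSingletonClass E] (hn : n ≠ 0) {r K : ℝ} (hr : 0 < r) (hK : 0 ≤ K)
    {z : Fin n → E} {h : E → ℝ} (hz : ∀ i, ‖fderiv ℝ h (z i)‖ ≤ K) : gradNorm (empirical z) r h ≤ K := by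
  have h0 : ∀ i, 0 ≤ ‖fderiv ℝ h (z i)‖ ^ r := fun i => Real.rpow_nonneg (norm_nonneg _) _
  have h1 : ∫ x, ‖fderiv ℝ h x‖ ^ r ∂(empirical z) ≤ K ^ r := by
    rw [integral_empirical, ← abs_of_nonneg (Finset.sum_nonneg fun i _ => h0 i)]
    refine inv_mul_abs_sum_le hn fun i => ?_
    rw [abs_of_nonneg (h0 i)]
    exact Real.rpow_le_rpow (norm_nonneg _) (hz i) hr.le
  calc gradNorm (empirical z) r h ≤ (K ^ r) ^ (1 / r) :=
        Real.rpow_le_rpow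
          (integral_nonneg fun _ => Real.rpow_nonneg (norm_nonneg _) _) h1 (by positivity)
    _ = K := by rw [one_div, Real.rpow_rpow_inv hK hr.ne']

theorem abs_risk_empirical_sub_le [NormedAddCommGroup E] [MeasurableSingletonClass E]
    (hn : n ≠ 0) {z z' : Fin n → E} {h : E → ℝ}
    {L : ℝ≥0} {D : Set E} (hL : LipschitzOnWith L h D) {b : ℝ} (hz : ∀ i, z i ∈ D) (hz' : ∀ i, z' i ∈ D)
    (hb : ∀ i, ‖z' i - z i‖ ≤ b) :
    |risk (empirical z) h - risk (empirical z') h| ≤ L * b := by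
  rw [risk, risk, integral_empirical, integral_empirical, ← mul_sub, ← Finset.sum_sub_distrib,
    abs_mul, abs_of_nonneg (by positivity : (0 : ℝ) ≤ (n : ℝ)⁻¹)]
  refine inv_mul_abs_sum_le hn fun i => ?_
  refine (hL.norm_sub_le (hz i) (hz' i)).trans ?_
  rw [norm_sub_rev]
  gcongr
  exact hb i

end Empirical

/-! ### Excess risk of a penalized minimizer -/

section ExcessRisk

variable {E : Type*} [NormedAddCommGroup E] [NormedSpace ℝ E] [MeasurableSpace E]

/-- A minimizer of the penalized `Q`-risk has small excess `P`-risk if the risks under `P` and `Q`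
are uniformly close and the penalty is bounded. -/
theorem abs_excessRisk_le {P Q : Measure E} {H : Set (E → ℝ)} {g : E → ℝ} {a p η K : ℝ}
    (hg : g ∈ H) (hbdd : BddBelow (Set.range fun h : H => risk P (h : E → ℝ)))
    (hη : ∀ h ∈ H, |risk P h - risk Q h| ≤ η) (ha : 0 ≤ a)
    (hK : ∀ h ∈ H, gradNorm Q (Real.conjExponent p) h ≤ K)
    (hmin : IsMinOn (penalizedRisk a p Q) H g) :
    |excessRisk P H g| ≤ 2 * η + a * K := by
  have : Nonempty H := ⟨⟨g, hg⟩⟩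
  have hnonneg : 0 ≤ excessRisk P H g := sub_nonneg.2 (ciInf_le hbdd ⟨g, hg⟩)
  rw [abs_of_nonneg hnonneg, excessRisk, sub_le_comm]
  refine le_ciInf fun ⟨h, hh⟩ => ?_
  have h1 : penalizedRisk a p Q g ≤ penalizedRisk a p Q h := hmin hh
  have h2 := abs_le.1 (hη g hg)
  have h3 := abs_le.1 (hη h hh)
  have h4 := mul_nonneg ha (gradNorm_nonneg Q (Real.conjExponent p) g)
  have h5 := mul_le_mul_of_nonneg_left (hK h hh) ha
  simp only [penalizedRisk] at h1
  dsimp only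
  linarith

end ExcessRisk

/-! ### The loss domain and extensions of the losses -/

section Domain

variable {E : Type*} [NormedAddCommGroup E] [NormedSpace ℝ E] {Z : Set E} {M : ℝ}

theorem isOpen_lossDomain (hZ : IsOpen Z) : IsOpen (lossDomain Z M) :=
  hZ.convexHull.add_right

theorem mem_lossDomain_of_norm_sub_le {z z' : E} (hz : z ∈ Z) (h : ‖z' - z‖ ≤ M) :
    z' ∈ lossDomain Z M :=
  ⟨z, subset_convexHull ℝ Z hz, z' - z, by simpa using h, by simp⟩

theorem subset_lossDomain (hM : 0 ≤ M) : Z ⊆ lossDomain Z M :=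
  fun _ hz => mem_lossDomain_of_norm_sub_le hz (by simpa using hM)

/-- A bounded real function that is Lipschitz on `D` agrees on `D` with a continuous function on
the whole space that has the same bound. -/
theorem exists_continuous_bounded_extension {X : Type*} [PseudoMetricSpace X] {D : Set X}
    {h : X → ℝ} {L : ℝ≥0} {B : ℝ} (hB0 : 0 ≤ B) (hL : LipschitzOnWith L h D)
    (hB : ∀ x ∈ D, |h x| ≤ B) :
    ∃ g : X → ℝ, Continuous g ∧ (∀ x, |g x| ≤ B) ∧ Set.EqOn g h D := by
  obtain ⟨g, hg, hgD⟩ := hL.extend_real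
  refine ⟨fun x => max (-B) (min B (g x)),
    continuous_const.max (continuous_const.min hg.continuous), fun x => ?_, fun x hx => ?_⟩
  · exact abs_le.2 ⟨le_max_left _ _, max_le (by linarith) (min_le_left _ _)⟩
  · have := abs_le.1 (hB x hx)
    simp only [← hgD hx, min_eq_right this.2, max_eq_right this.1]

end Domain

/-! ### Uniform deviations over the class -/

section Deviation

variable {n : ℕ}

/-- The Rademacher complexity depends only on the restrictions of the losses to a set of full
measure, so it may be computed from the continuous extensions, whose signed suprema are
integrable. -/
theorem rademacherComplexity_eq {E : Type*} [NormedAddCommGroup E] [MeasurableSpace E]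
    [SecondCountableTopology E] [OpensMeasurableSpace E]
    {P : Measure E} [IsProbabilityMeasure P] {H : Set (E → ℝ)} [Nonempty H]
    {f : H → E → ℝ} {B : ℝ} (hf : ∀ h, Continuous (f h)) (hB : ∀ h x, |f h x| ≤ B)
    {Z : Set E} (hPZ : ∀ᵐ z ∂P, z ∈ Z) (hfZ : ∀ h : H, Set.EqOn (f h) (h : E → ℝ) Z) :
    rademacherComplexity P n H =
      (n : ℝ)⁻¹ * (((2 : ℝ) ^ n)⁻¹ *
        ∑ σ : Fin n → ℤˣ, ∫ z, signedSup f σ z ∂(Measure.pi fun _ => P)) := by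
  have hae : ∀ᵐ z ∂(Measure.pi fun _ : Fin n => P), ∀ i, z i ∈ Z :=
    ae_all_iff.2 fun i => (measurePreserving_eval (fun _ : Fin n => P) i).quasiMeasurePreserving.ae
      hPZ
  have hcongr : ∀ᵐ z ∂(Measure.pi fun _ : Fin n => P),
      ((2 : ℝ) ^ n)⁻¹ * ∑ σ : Fin n → ℤˣ, (n : ℝ)⁻¹ *
          ⨆ s : H, |∑ i, (((σ i : ℤˣ) : ℤ) : ℝ) * (s : E → ℝ) (z i)| =
        (n : ℝ)⁻¹ * (((2 : ℝ) ^ n)⁻¹ * ∑ σ : Fin n → ℤˣ, signedSup f σ z) := by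
    filter_upwards [hae] with z hz
    rw [← Finset.mul_sum, mul_left_comm]
    simp only [signedSup, hfZ _ (hz _)]
  rw [rademacherComplexity, integral_congr_ae hcongr, integral_const_mul, integral_const_mul,
    integral_finsetSum _ fun σ _ => integrable_signedSup hf hB _ σ]

/-- Markov's inequality for the uniform deviation of an i.i.d. sample. -/
theorem mul_measureReal_centredSup_le {V ι Ω : Type*} [Nonempty ι] [TopologicalSpace V]
    [SecondCountableTopology V] [MeasurableSpace V] [OpensMeasurableSpace V]
    {P : Measure V} [IsProbabilityMeasure P] [MeasurableSpace Ω] {μ : Measure Ω}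
    [IsProbabilityMeasure μ] {X : ℕ → Ω → V} (hX : ∀ i, Measurable (X i))
    (hind : iIndepFun X μ) (hlaw : ∀ i, μ.map (X i) = P)
    {f : ι → V → ℝ} {B : ℝ} (hf : ∀ i, Continuous (f i)) (hB : ∀ i x, |f i x| ≤ B)
    (n : ℕ) (t : ℝ) :
    t * μ.real {ω | t ≤ centredSup P f fun i : Fin n => X i ω} ≤
      2 * (((2 : ℝ) ^ n)⁻¹ *
        ∑ σ : Fin n → ℤˣ, ∫ z, signedSup f σ z ∂(Measure.pi fun _ => P)) := by
  have hmeas : Measurable fun ω (i : Fin n) => X i ω := measurable_pi_lambda _ fun i => hX i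
  have hmap : μ.map (fun ω (i : Fin n) => X i ω) = Measure.pi fun _ => P := by
    have h := (iIndepFun_iff_map_fun_eq_pi_map fun i : Fin n => (hX i).aemeasurable).1
      (hind.precomp Fin.val_injective)
    simpa only [hlaw] using h
  have hmp : MeasurePreserving (fun ω (i : Fin n) => X i ω) μ (Measure.pi fun _ => P) :=
    ⟨hmeas, hmap⟩
  have hint := integrable_centredSup (n := n) P hf hB (Measure.pi fun _ => P)
  have heq : ∫ ω, centredSup P f (fun i : Fin n => X i ω) ∂μ =
      ∫ z : Fin n → V, centredSup P f z ∂(Measure.pi fun _ => P) := by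
    rw [← hmap, integral_map hmeas.aemeasurable]
    rw [hmap]; exact hint.aestronglyMeasurable
  calc _ ≤ ∫ ω, centredSup P f (fun i : Fin n => X i ω) ∂μ :=
        mul_meas_ge_le_integral_of_nonneg
          (Eventually.of_forall fun ω => Real.iSup_nonneg fun i => abs_nonneg _)
          (hmp.integrable_comp_of_integrable hint) t
    _ ≤ _ := heq.trans_le (integral_centredSup_le P hf hB)

end Deviation

/-! ### The excess-risk bound -/

section Rate

/-- On the sample space, the risks of the losses under `P` and under a perturbed empirical measure
differ by at most the uniform deviation of the sample plus `L` times the perturbation size. -/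
theorem abs_risk_sub_risk_empirical_le {E : Type*} [NormedAddCommGroup E] [MeasurableSpace E]
    [MeasurableSingletonClass E] {P : Measure E} {H : Set (E → ℝ)} {f : H → E → ℝ} {B : ℝ}
    [IsProbabilityMeasure P] (hB : ∀ h x, |f h x| ≤ B) {D : Set E} (hPD : ∀ᵐ z ∂P, z ∈ D)
    (hfD : ∀ h : H, Set.EqOn (f h) (h : E → ℝ) D) {L : ℝ≥0}
    (hL : ∀ h ∈ H, LipschitzOnWith L h D) {n : ℕ} (hn : n ≠ 0) {z z' : Fin n → E} {b : ℝ}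
    (hz : ∀ i, z i ∈ D) (hz' : ∀ i, z' i ∈ D) (hb : ∀ i, ‖z' i - z i‖ ≤ b)
    {h : E → ℝ} (hh : h ∈ H) :
    |risk P h - risk (empirical z') h| ≤ (n : ℝ)⁻¹ * centredSup P f z + L * b := by
  have hdev : |risk P h - risk (empirical z) h| ≤ (n : ℝ)⁻¹ * centredSup P f z := by
    have hrisk : risk P h = ∫ x, f ⟨h, hh⟩ x ∂P :=
      integral_congr_ae (by filter_upwards [hPD] with x hx using (hfD ⟨h, hh⟩ hx).symm)
    have heq : risk (empirical z) h - risk P h =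
        (n : ℝ)⁻¹ * ∑ j, (f ⟨h, hh⟩ (z j) - ∫ x, f ⟨h, hh⟩ x ∂P) := by
      rw [hrisk, risk, integral_empirical, Finset.sum_sub_distrib, mul_sub]
      simp [hfD ⟨h, hh⟩ (hz _), hn]
    rw [abs_sub_comm, heq, abs_mul, abs_of_nonneg (by positivity : (0 : ℝ) ≤ (n : ℝ)⁻¹)]
    gcongr
    exact abs_le_iSup_abs (g := fun h (z : Fin n → E) => ∑ j, (f h (z j) - ∫ x, f h x ∂P))
      (fun h z => abs_sum_fin_le fun j =>
        abs_sub_le_add_self (hB h (z j)) (abs_integral_le_of_abs_le P (hB h))) z ⟨h, hh⟩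
  exact (abs_sub_le _ _ _).trans
    (add_le_add hdev (abs_risk_empirical_sub_le hn (hL h hh) hz hz' hb))

end Rate

end PerturbedWDRO

open PerturbedWDRO

theorem theorem6
    -- `E` is `ℝ^d` with an arbitrary norm
    {E : Type*} [NormedAddCommGroup E] [NormedSpace ℝ E] [FiniteDimensional ℝ E]
    [MeasurableSpace E] [BorelSpace E]
    -- the sample space and the data distribution
    (Z : Set E) (hZ_open : IsOpen Z) (hZ_bdd : Bornology.IsBounded Z)
    (P : Measure E) [IsProbabilityMeasure P] (hPZ : ∀ᵐ z ∂P, z ∈ Z)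
    -- the i.i.d. sample
    {Ω : Type*} [MeasurableSpace Ω] (μ : Measure Ω) [IsProbabilityMeasure μ]
    (X : ℕ → Ω → E) (hX_meas : ∀ i, Measurable (X i)) (hX_indep : iIndepFun X μ)
    (hX_law : ∀ i, μ.map (X i) = P)
    -- the radii, the perturbation sizes and the constants
    (α β : ℕ → ℝ) (hα_pos : ∀ n, 1 ≤ n → 0 < α n) (hβ_pos : ∀ n, 1 ≤ n → 0 < β n)
    (hα_lim : Tendsto α atTop (𝓝 0)) (hβ_lim : Tendsto β atTop (𝓝 0))
    (CH Cgrad : ℝ) (hCH : 0 < CH) (hCgrad : 0 < Cgrad) (L : ℝ≥0) (hL : 0 < L)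
    (k : ℝ) (hk_pos : 0 < k) (hk_le : k ≤ 1)
    (M : ℝ) (hM : ∀ n, 1 ≤ n → β n ≤ M)
    (p : ℝ) (hp : 1 + k < p)
    -- the class of losses; only the values on `Conv(Z) + B(M)` matter
    (H : Set (E → ℝ))
    (hH_bdd : ∃ B : ℝ, ∀ h ∈ H, ∀ z ∈ PerturbedWDRO.lossDomain Z M, |h z| ≤ B)
    (hH_diff : ∀ h ∈ H, ∀ z ∈ PerturbedWDRO.lossDomain Z M, DifferentiableAt ℝ h z)
    (hH_holder : ∀ h ∈ H, ∀ z ∈ PerturbedWDRO.lossDomain Z M,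
      ∀ w ∈ PerturbedWDRO.lossDomain Z M,
        ‖fderiv ℝ h z - fderiv ℝ h w‖ ≤ CH * ‖z - w‖ ^ k)
    (hH_grad : ∀ h ∈ H, Cgrad ≤ ∫ z, ‖fderiv ℝ h z‖ ∂P)
    (hH_lip : ∀ h ∈ H, LipschitzOnWith L h (PerturbedWDRO.lossDomain Z M))
    -- the locally perturbed data distributions
    (P' : ℕ → Ω → Measure E)
    (hP' : ∀ n, 1 ≤ n → ∀ᵐ ω ∂μ,
      PerturbedWDRO.IsLocallyPerturbed (β n) (fun i : Fin n => X i ω) (P' n ω))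
    -- the minimizers of the penalized objective
    (hhat : ℕ → Ω → E → ℝ)
    (hhat_mem : ∀ n, 1 ≤ n → ∀ᵐ ω ∂μ, hhat n ω ∈ H)
    (hhat_min : ∀ n, 1 ≤ n → ∀ᵐ ω ∂μ,
      IsMinOn (PerturbedWDRO.penalizedRisk (α n) p (P' n ω)) H (hhat n ω)) :
    PerturbedWDRO.IsBigOInProb μ
      (fun n ω => PerturbedWDRO.excessRisk P H (hhat n ω))
      (fun n => max (max (max (PerturbedWDRO.rademacherComplexity P n H)
          ((n : ℝ) ^ (-(1 / 2) : ℝ))) (α n))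
        (Real.log n * max (α n ^ (1 + k)) (β n))) := by
  have : ProperSpace E := FiniteDimensional.proper_real E
  have : SecondCountableTopology E := inferInstance
  obtain ⟨ω₀, hω₀⟩ := (hhat_mem 1 le_rfl).exists
  have : Nonempty H := ⟨⟨_, hω₀⟩⟩
  have hM0 : 0 ≤ M := (hβ_pos 1 le_rfl).le.trans (hM 1 le_rfl)
  have hZD : Z ⊆ lossDomain Z M := subset_lossDomain hM0
  have hPD : ∀ᵐ z ∂P, z ∈ lossDomain Z M := hPZ.mono fun z hz => hZD hz
  have hr : 0 < Real.conjExponent p := by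
    rw [Real.conjExponent]
    exact div_pos (by linarith) (by linarith)
  obtain ⟨B, hB⟩ := hH_bdd
  obtain ⟨x₀, hx₀⟩ := hPD.exists
  have hB0 : 0 ≤ B := (abs_nonneg _).trans (hB _ hω₀ x₀ hx₀)
  choose f hf hfB hfD using fun h : H =>
    exists_continuous_bounded_extension hB0 (hH_lip h h.2) (hB h h.2)
  have hbdd : BddBelow (Set.range fun h : H => risk P (h : E → ℝ)) := by
    refine ⟨-B, ?_⟩
    rintro _ ⟨h, rfl⟩
    have hrisk : risk P h = ∫ x, f h x ∂P :=
      integral_congr_ae (by filter_upwards [hPD] with x hx using (hfD h hx).symm)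
    simpa only [hrisk] using (abs_le.1 (abs_integral_le_of_abs_le P (hfB h))).1
  intro ε hε
  refine ⟨3 * L + 8 / ε, 3, fun n hn => ?_⟩
  have hn1 : 1 ≤ n := by omega
  have hn0 : n ≠ 0 := by omega
  have hnpos : (0 : ℝ) < n := by positivity
  set a : ℝ := max (max (max (rademacherComplexity P n H) ((n : ℝ) ^ (-(1 / 2) : ℝ))) (α n))
    (Real.log n * max (α n ^ (1 + k)) (β n)) with ha
  have haR : rademacherComplexity P n H ≤ a :=
    (le_max_left _ _).trans ((le_max_left _ _).trans (le_max_left _ _))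
  have haα : α n ≤ a := (le_max_right _ _).trans (le_max_left _ _)
  have ha0 : 0 < a := (hα_pos n hn1).trans_le haα
  have haβ : β n ≤ a := by
    -- The factor `log n` is at least `1` because `n ≥ 3 > e`.
    have hlog : 1 ≤ Real.log n := by
      rw [Real.le_log_iff_exp_le hnpos]
      have : (3 : ℝ) ≤ n := by exact_mod_cast hn
      linarith [Real.exp_one_lt_d9]
    have hmax : β n ≤ max (α n ^ (1 + k)) (β n) := le_max_right _ _
    calc β n ≤ 1 * max (α n ^ (1 + k)) (β n) := by rwa [one_mul]
      _ ≤ Real.log n * max (α n ^ (1 + k)) (β n) := by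
        gcongr
        exact (hβ_pos n hn1).le.trans hmax
      _ ≤ a := le_max_right _ _
  have hXZ : ∀ᵐ ω ∂μ, ∀ i : Fin n, X i ω ∈ Z := ae_all_iff.2 fun i =>
    ae_of_ae_map (hX_meas i).aemeasurable (by rwa [hX_law i])
  -- Almost surely, a large excess risk forces a large uniform deviation of the sample.
  have hsub : {ω | (3 * L + 8 / ε) * a < |excessRisk P H (hhat n ω)|} ≤ᵐ[μ]
      {ω | n * (4 / ε) * a ≤ centredSup P f fun i : Fin n => X i ω} := by
    filter_upwards [hXZ, hP' n hn1, hhat_mem n hn1, hhat_min n hn1] with ω hX hQ hmem hmin hω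
    obtain ⟨z', hQ, hz'⟩ := hQ
    have hz'D : ∀ i, z' i ∈ lossDomain Z M := fun i =>
      mem_lossDomain_of_norm_sub_le (hX i) ((hz' i).trans (hM n hn1))
    rw [hQ] at hmin
    have hex := abs_excessRisk_le hmem hbdd
      (fun h hh => abs_risk_sub_risk_empirical_le hfB hPD hfD hH_lip hn0
        (fun i => hZD (hX i)) hz'D hz' hh) (hα_pos n hn1).le
      (fun h hh => gradNorm_empirical_le hn0 hr L.coe_nonneg fun i =>
        norm_fderiv_le_of_lipschitzOn ℝ
          ((isOpen_lossDomain hZ_open).mem_nhds (hz'D i)) (hH_lip h hh)) hmin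
    have hω' : (3 * L + 8 / ε) * a < |excessRisk P H (hhat n ω)| := hω
    have h1 : (L : ℝ) * β n ≤ L * a := by gcongr
    have h2 : α n * L ≤ a * L := by gcongr
    have h3 : 4 / ε * a ≤ (n : ℝ)⁻¹ * centredSup P f fun i : Fin n => X i ω := by
      have : 8 / ε = 2 * (4 / ε) := by ring
      rw [this] at hω'
      linarith
    change (n : ℝ) * (4 / ε) * a ≤ _
    rwa [le_inv_mul_iff₀ hnpos, ← mul_assoc] at h3
  refine (measure_mono_ae hsub).trans_lt ?_
  rw [← ENNReal.ofReal_toReal (measure_ne_top μ _)]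
  refine (ENNReal.ofReal_lt_ofReal_iff hε).2 ?_
  have hmarkov := mul_measureReal_centredSup_le hX_meas hX_indep hX_law hf hfB n (n * (4 / ε) * a)
  have hR := rademacherComplexity_eq (n := n) hf hfB hPD hfD
  rw [eq_inv_mul_iff_mul_eq₀ hnpos.ne'] at hR
  rw [← hR] at hmarkov
  set q := μ.real {ω | n * (4 / ε) * a ≤ centredSup P f fun i : Fin n => X i ω}
  change q < ε
  have h1 : n * (4 / ε) * a * q ≤ n * (4 / ε) * a * (ε / 2) := by
    calc n * (4 / ε) * a * q ≤ 2 * (n * rademacherComplexity P n H) := hmarkov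
      _ ≤ 2 * (n * a) := by gcongr
      _ = n * (4 / ε) * a * (ε / 2) := by field_simp; norm_num
  have h2 : q ≤ ε / 2 := le_of_mul_le_mul_left h1 (by positivity)
  linarith
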